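/- Let $\pi:F\to M$ be a smooth real vector bundle of finite rank over a smooth manifold $M$ (finite-dimensional, Hausdorff, paracompact, without boundary), and for $t\ge 0$ let $h_t:F\to F$, $h_t(v)=t\cdot v$, be the homotheties of $F$. Let $E\subset F$ be a smooth embedded submanifold of the total space (different connected components of a submanifold are allowed to have different dimensions) such that $h_t(E)\subset E$ for all $t\ge 0$. Then $E$ is a smooth vector subbundle of $F$ over a submanifold of the base: there is a smooth embedded submanifold $N\subset M$ such that $E\subset\pi^{-1}(N)$ and every $x\in N$ has an open neighbourhood $U$ in $M$ with a smooth, fiberwise linear trivialization $\pi^{-1}(U)\cong U\times\mathbb{R}^k$ ($k$ the rank of $F$ near $x$) which identifies $E\cap\pi^{-1}(U)$ with $(N\cap U)\times L$ for some linear subspace $L\subset\mathbb{R}^k$. In particular, $E\cap\pi^{-1}(x)$ is a linear subspace of the fiber $\pi^{-1}(x)$ for every $x\in N$, and $N=\pi(E)$. -/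

import Mathlib

open Bundle Set
open scoped Manifold ContDiff

/-- `S` is a (smooth, embedded) submanifold of the boundaryless manifold `X`: around each of its
points there is a smooth chart of `X` in which `S` is a linear subspace (a slice). The dimension
of the slice may depend on the point, so it is constant on each connected component of `S`, but
different components may have different dimensions. -/
def IsEmbeddedSubmanifold {E : Type*} [NormedAddCommGroup E] [NormedSpace ℝ E]
    {H : Type*} [TopologicalSpace H] (I : ModelWithCorners ℝ E H) [I.Boundaryless]
    {X : Type*} [TopologicalSpace X] [ChartedSpace H X] (S : Set X) : Prop :=
  ∀ p ∈ S, ∃ φ ∈ IsManifold.maximalAtlas I ∞ X, p ∈ φ.source ∧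
    ∃ L : Submodule ℝ E, ∀ q ∈ φ.source, q ∈ S ↔ I (φ q) ∈ L

/-- The homothety `h_t(v) = t • v` of the total space of a vector bundle. -/
def homothety {M : Type*} (F : Type*) (V : M → Type*)
    [∀ x, AddCommGroup (V x)] [∀ x, Module ℝ (V x)] (t : ℝ) (p : TotalSpace F V) :
    TotalSpace F V :=
  ⟨p.proj, t • p.snd⟩

/-- A smooth local trivialization of the vector bundle `V`: it is linear in the fibers, and it is
a diffeomorphism from the part of the bundle over its base set onto `baseSet × F`. -/
structure IsSmoothLinearTrivialization {B : Type*} [NormedAddCommGroup B] [NormedSpace ℝ B]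
    {H : Type*} [TopologicalSpace H] (I : ModelWithCorners ℝ B H)
    {M : Type*} [TopologicalSpace M] [ChartedSpace H M]
    {F : Type*} [NormedAddCommGroup F] [NormedSpace ℝ F]
    {V : M → Type*} [∀ x, AddCommGroup (V x)] [∀ x, Module ℝ (V x)]
    [TopologicalSpace (TotalSpace F V)] [∀ x, TopologicalSpace (V x)] [FiberBundle F V]
    (e : Trivialization F (π F V)) : Prop where
  linear : e.IsLinear ℝ
  contMDiffOn_toFun : ContMDiffOn (I.prod 𝓘(ℝ, F)) (I.prod 𝓘(ℝ, F)) ∞ e e.source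
  contMDiffOn_symm : ContMDiffOn (I.prod 𝓘(ℝ, F)) (I.prod 𝓘(ℝ, F)) ∞
    e.toOpenPartialHomeomorph.symm e.target

/-- The subset `S` of the total space of the vector bundle `V → M` is a smooth vector subbundle
over the submanifold `N` of `M`: the set `N` is a submanifold of `M`, the set `S` lies over `N`,
and each point of `N` has a neighbourhood `U` in `M` over which there is a smooth linear
trivialization of `V` that identifies `S` over `U` with `(N ∩ U) × L` for a linear subspace `L`
of the typical fiber. In particular `S ∩ V x` is a linear subspace of `V x` for `x ∈ N`; its rank
is locally constant on `N`. -/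
structure IsVectorSubbundleOver {B : Type*} [NormedAddCommGroup B] [NormedSpace ℝ B]
    {H : Type*} [TopologicalSpace H] (I : ModelWithCorners ℝ B H) [I.Boundaryless]
    {M : Type*} [TopologicalSpace M] [ChartedSpace H M]
    {F : Type*} [NormedAddCommGroup F] [NormedSpace ℝ F]
    {V : M → Type*} [∀ x, AddCommGroup (V x)] [∀ x, Module ℝ (V x)]
    [TopologicalSpace (TotalSpace F V)] [∀ x, TopologicalSpace (V x)] [FiberBundle F V]
    (N : Set M) (S : Set (TotalSpace F V)) : Prop where
  isEmbeddedSubmanifold_base : IsEmbeddedSubmanifold I N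
  proj_mem : ∀ p ∈ S, p.proj ∈ N
  exists_adapted_trivialization : ∀ x ∈ N, ∃ e : Trivialization F (π F V),
    IsSmoothLinearTrivialization I e ∧ x ∈ e.baseSet ∧
      ∃ L : Submodule ℝ F, ∀ p : TotalSpace F V, p.proj ∈ N ∩ e.baseSet →
        (p ∈ S ↔ (e p).2 ∈ L)

/-! Multiplication by `0` retracts `S` onto its zero vectors, so the base must be the set of `x`
whose zero vector lies in `S`, and the question is local at a point `(b₀, 0)` of a set `S ⊆ B × F`.
The differential of the retraction preserves the tangent space of `S` there, which is therefore a
product `P × Q`. With projections `p`, `q` onto `P`, `Q`, `exists_normalized_slice_chart` gives a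
chart `X` carrying `S` to `P × Q` without altering `p`- and `q`-components, up to translation.

In `exists_local_product_form`, `b ↦ (X (b, 0)).1` straightens the base to `P`, and the fiber
derivative `A b` of `(X ·).2` at `(b, 0)` straightens the fibers to `Q`. Shrinking a vector of `S`
towards zero shows that `A b` sends it into `Q`. Conversely, `X.symm` produces short vectors of `S`
over `b` with any prescribed small value of `A b` in `Q`, and homotheties reach the long ones.
Twisting a trivialization of the bundle by `A` (`exists_twist`) then makes the fibers constant. -/

open scoped Topology

/-! ### Linear algebra and the inverse function theorem -/

/-- Every subspace of a finite-dimensional space is the range of a continuous projection. -/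
theorem Submodule.exists_continuous_projection {E : Type*} [NormedAddCommGroup E]
    [NormedSpace ℝ E] [FiniteDimensional ℝ E] (T : Submodule ℝ E) :
    ∃ p : E →L[ℝ] E, (∀ x, p x ∈ T) ∧ ∀ x ∈ T, p x = x := by
  obtain ⟨g, hg⟩ := T.subtype.exists_leftInverse_of_injective T.ker_subtype
  refine ⟨LinearMap.toContinuousLinearMap (T.subtype ∘ₗ g), fun x => (g x).2, fun x hx => ?_⟩
  have := LinearMap.congr_fun hg ⟨x, hx⟩
  simpa using congrArg Subtype.val this

/-- A curve in a subspace has its one-sided derivative in that subspace. -/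
theorem Submodule.mem_of_hasDerivWithinAt_Ici {E : Type*} [NormedAddCommGroup E]
    [NormedSpace ℝ E] [FiniteDimensional ℝ E] {L : Submodule ℝ E} {c : ℝ → E} {c' : E}
    (hc : HasDerivWithinAt c c' (Ici 0) 0) (hL : ∀ᶠ s in 𝓝[≥] (0 : ℝ), c s ∈ L) : c' ∈ L := by
  obtain ⟨p, hp, hp'⟩ := L.exists_continuous_projection
  have hd := (p.hasFDerivAt (x := c 0)).comp_hasDerivWithinAt (0 : ℝ) hc
  -- Since `c = p ∘ c` near `0`, differentiating gives `c' = p c'`.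
  have he : c =ᶠ[𝓝[≥] (0 : ℝ)] p ∘ c := by
    filter_upwards [hL] with s hs
    exact (hp' _ hs).symm
  have h1 := hd.congr_of_eventuallyEq he (he.self_of_nhdsWithin self_mem_Ici)
  rw [(uniqueDiffOn_Ici (0 : ℝ) 0 self_mem_Ici).eq_deriv _ hc h1]
  exact hp _

/-- The inverse function theorem for smooth maps, on open sets. -/
theorem ContDiffOn.exists_openPartialHomeomorph {E : Type*} [NormedAddCommGroup E]
    [NormedSpace ℝ E] [CompleteSpace E] {f : E → E} {Ω : Set E} {a : E}
    (hf : ContDiffOn ℝ ∞ f Ω) (hΩ : IsOpen Ω) (ha : a ∈ Ω)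
    (hd : HasFDerivAt f (ContinuousLinearMap.id ℝ E) a) :
    ∃ χ : OpenPartialHomeomorph E E, a ∈ χ.source ∧ χ.source ⊆ Ω ∧ (∀ x, χ x = f x) ∧
      ContDiffOn ℝ ∞ χ.symm χ.target := by
  have hcf : ContDiffAt ℝ ∞ f a := hf.contDiffAt (hΩ.mem_nhds ha)
  have hd' : HasFDerivAt f ((ContinuousLinearEquiv.refl ℝ E : E ≃L[ℝ] E) : E →L[ℝ] E) a := hd
  set χ := hcf.toOpenPartialHomeomorph f hd' (by simp) with hχ
  have hmem : a ∈ χ.source := hcf.mem_toOpenPartialHomeomorph_source hd' (by simp)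
  have hcoe : ∀ x, χ x = f x := fun x => rfl
  have hcont : ContinuousOn (fderiv ℝ f) Ω :=
    hf.continuousOn_fderiv_of_isOpen hΩ (by simp)
  -- Restricting to points with invertible derivative makes the inverse smooth on the whole target,
  -- not only near `f a`.
  have hopen : IsOpen (Ω ∩ fderiv ℝ f ⁻¹' range ((↑) : (E ≃L[ℝ] E) → E →L[ℝ] E)) :=
    hcont.isOpen_inter_preimage hΩ ContinuousLinearEquiv.isOpen
  set O := Ω ∩ fderiv ℝ f ⁻¹' range ((↑) : (E ≃L[ℝ] E) → E →L[ℝ] E)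
  have haO : a ∈ O := ⟨ha, ⟨ContinuousLinearEquiv.refl ℝ E, hd'.fderiv.symm⟩⟩
  refine ⟨χ.restrOpen O hopen, ⟨hmem, haO⟩, fun x hx => hx.2.1, fun x => rfl, fun y hy => ?_⟩
  have hy' := (χ.restrOpen O hopen).map_target hy
  obtain ⟨⟨D, hD⟩, hyΩ⟩ := And.intro hy'.2.2 hy'.2.1
  have hcd := hf.contDiffAt (hΩ.mem_nhds hyΩ)
  have hfd := (hcd.differentiableAt (by simp)).hasFDerivAt
  rw [← hD] at hfd
  exact ((χ.restrOpen O hopen).contDiffAt_symm hy hfd hcd).contDiffWithinAt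

/-- The derivative of a smooth local diffeomorphism is invertible. -/
theorem OpenPartialHomeomorph.exists_hasFDerivAt_equiv {E : Type*} [NormedAddCommGroup E]
    [NormedSpace ℝ E] {Φ : OpenPartialHomeomorph E E} (h : ContDiffOn ℝ ∞ Φ Φ.source)
    (h' : ContDiffOn ℝ ∞ Φ.symm Φ.target) {a : E} (ha : a ∈ Φ.source) :
    ∃ D : E ≃L[ℝ] E, HasFDerivAt Φ (D : E →L[ℝ] E) a ∧
      HasFDerivAt Φ.symm (D.symm : E →L[ℝ] E) (Φ a) := by
  have hd := ((h.contDiffAt (Φ.open_source.mem_nhds ha)).differentiableAt (by simp)).hasFDerivAt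
  have hta := Φ.map_source ha
  have hd' := ((h'.contDiffAt (Φ.open_target.mem_nhds hta)).differentiableAt
    (by simp)).hasFDerivAt
  have h1 := hd'.comp a hd
  have h2 : HasFDerivAt (Φ.symm ∘ Φ) (ContinuousLinearMap.id ℝ E) a :=
    (hasFDerivAt_id a).congr_of_eventuallyEq (Φ.eventually_left_inverse ha)
  have hd3 := hd
  rw [← Φ.left_inv ha] at hd3
  have h3 := HasFDerivAt.comp (Φ a) (g := Φ) hd3 hd'
  have h4 : HasFDerivAt (Φ ∘ Φ.symm) (ContinuousLinearMap.id ℝ E) (Φ a) :=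
    (hasFDerivAt_id _).congr_of_eventuallyEq (Φ.eventually_right_inverse hta)
  have e1 := h1.unique h2
  have e2 := h3.unique h4
  rw [Φ.left_inv ha] at e2
  exact ⟨ContinuousLinearEquiv.equivOfInverse _ _ (fun x => DFunLike.congr_fun e1 x)
    (fun x => DFunLike.congr_fun e2 x), hd, hd'⟩

theorem Submodule.mem_iff_add_sub_mem {E : Type*} [AddCommGroup E] [Module ℝ E]
    (A : Submodule ℝ E) {a c : E} (d : E) (ha : a ∈ A) (hc : c ∈ A) :
    d ∈ A ↔ a + (d - c) ∈ A := by
  rw [A.add_mem_iff_right ha, A.sub_mem_iff_left hc]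

/-! ### Local form of homothety-stable submanifolds of `B × F` -/

section Cone

variable {B F : Type*} [NormedAddCommGroup B] [NormedSpace ℝ B] [FiniteDimensional ℝ B]
  [NormedAddCommGroup F] [NormedSpace ℝ F] [FiniteDimensional ℝ F]

/-- A submanifold of `B × F` that is stable under the projection to `B × 0` has, at each of its
points in `B × 0`, a slice chart `X` with derivative the identity which moves points only in
a direction transverse to the tangent space, and this tangent space is a product. -/
theorem exists_normalized_slice_chart {S : Set (B × F)} (h0 : ∀ p ∈ S, (p.1, (0 : F)) ∈ S)
    {Φ : OpenPartialHomeomorph (B × F) (B × F)} (hΦ : ContDiffOn ℝ ∞ Φ Φ.source)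
    (hΦ' : ContDiffOn ℝ ∞ Φ.symm Φ.target) {b₀ : B} (hb₀ : (b₀, (0 : F)) ∈ Φ.source)
    (hbS : (b₀, (0 : F)) ∈ S) {L : Submodule ℝ (B × F)}
    (hL : ∀ p ∈ Φ.source, p ∈ S ↔ Φ p ∈ L) :
    ∃ (X : OpenPartialHomeomorph (B × F) (B × F)) (P : Submodule ℝ B) (Q : Submodule ℝ F)
      (p : B →L[ℝ] B) (q : F →L[ℝ] F),
      (∀ b, p b ∈ P) ∧ (∀ b ∈ P, p b = b) ∧ (∀ f, q f ∈ Q) ∧ (∀ f ∈ Q, q f = f) ∧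
      (b₀, (0 : F)) ∈ X.source ∧ X.source ⊆ Φ.source ∧ ContDiffOn ℝ ∞ X X.source ∧
      HasFDerivAt X (ContinuousLinearMap.id ℝ (B × F)) (b₀, 0) ∧ X (b₀, 0) = 0 ∧
      (∀ z ∈ X.source, z ∈ S ↔ (X z).1 ∈ P ∧ (X z).2 ∈ Q) ∧
      (∀ z, p (X z).1 = p (z.1 - b₀)) ∧ ∀ z, q (X z).2 = q z.2 := by
  obtain ⟨D, hD, hD'⟩ := Φ.exists_hasFDerivAt_equiv hΦ hΦ' hb₀
  have hΦL : Φ (b₀, 0) ∈ L := (hL _ hb₀).1 hbS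
  -- The differential of the projection `j` to `B × 0` preserves the tangent space `D⁻¹ L`: apply
  -- `j` to the curve in `S` that `Φ` maps to a line with velocity `D v`.
  have hT0 : ∀ v : B × F, D v ∈ L → D (v.1, 0) ∈ L := by
    intro v hv
    set j : B × F →L[ℝ] B × F :=
      (ContinuousLinearMap.inl ℝ B F).comp (ContinuousLinearMap.fst ℝ B F) with hj
    have hjv : ∀ z, j z = (z.1, 0) := fun z => rfl
    have hl : HasDerivAt (fun s : ℝ => Φ (b₀, 0) + s • D v) (D v) 0 := by
      simpa using ((hasDerivAt_id (0 : ℝ)).smul_const (D v)).const_add (Φ (b₀, 0))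
    have hl0 : Φ (b₀, 0) + (0 : ℝ) • D v = Φ (b₀, 0) := by simp
    have hg : HasDerivAt (fun s : ℝ => Φ.symm (Φ (b₀, 0) + s • D v)) v 0 := by
      rw [← hl0] at hD'
      exact (hD'.comp_hasDerivAt (0 : ℝ) hl).congr_deriv (D.symm_apply_apply v)
    have hg0 : Φ.symm (Φ (b₀, 0) + (0 : ℝ) • D v) = (b₀, 0) := by
      rw [hl0, Φ.left_inv hb₀]
    have hjg : HasDerivAt (fun s : ℝ => j (Φ.symm (Φ (b₀, 0) + s • D v))) (j v) 0 :=
      j.hasFDerivAt.comp_hasDerivAt (0 : ℝ) hg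
    have hjg0 : j (Φ.symm (Φ (b₀, 0) + (0 : ℝ) • D v)) = (b₀, 0) := by rw [hg0]; rfl
    have hc : HasDerivAt (fun s : ℝ => Φ (j (Φ.symm (Φ (b₀, 0) + s • D v)))) (D (j v)) 0 := by
      rw [← hjg0] at hD
      exact hD.comp_hasDerivAt (0 : ℝ) hjg
    refine Submodule.mem_of_hasDerivWithinAt_Ici hc.hasDerivWithinAt
      (Filter.Eventually.filter_mono nhdsWithin_le_nhds ?_)
    have ht : ∀ᶠ s : ℝ in 𝓝 0, Φ (b₀, 0) + s • D v ∈ Φ.target :=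
      hl.continuousAt.eventually_mem
        (Φ.open_target.mem_nhds (by simpa using Φ.map_source hb₀))
    have hs : ∀ᶠ s : ℝ in 𝓝 0, j (Φ.symm (Φ (b₀, 0) + s • D v)) ∈ Φ.source :=
      hjg.continuousAt.eventually_mem (Φ.open_source.mem_nhds (by rw [hjg0]; exact hb₀))
    filter_upwards [ht, hs] with s hst hss
    refine (hL _ hss).1 (h0 _ ((hL _ (Φ.map_target hst)).2 ?_))
    rw [Φ.right_inv hst]
    exact L.add_mem hΦL (L.smul_mem _ hv)
  set P : Submodule ℝ B :=
    L.comap ((D : B × F →L[ℝ] B × F).comp (ContinuousLinearMap.inl ℝ B F)).toLinearMap with hP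
  set Q : Submodule ℝ F :=
    L.comap ((D : B × F →L[ℝ] B × F).comp (ContinuousLinearMap.inr ℝ B F)).toLinearMap with hQ
  have hPm : ∀ b, b ∈ P ↔ D (b, 0) ∈ L := fun b => Iff.rfl
  have hQm : ∀ f, f ∈ Q ↔ D (0, f) ∈ L := fun b => Iff.rfl
  have hT : ∀ v : B × F, D v ∈ L ↔ v.1 ∈ P ∧ v.2 ∈ Q := by
    intro v
    have hv : D v = D (v.1, 0) + D (0, v.2) := by rw [← map_add]; simp
    rw [hPm, hQm]
    refine ⟨fun h => ⟨hT0 v h, ?_⟩, fun h => hv ▸ L.add_mem h.1 h.2⟩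
    have := L.sub_mem h (hT0 v h)
    rwa [hv, add_sub_cancel_left] at this
  obtain ⟨p, hp, hp'⟩ := P.exists_continuous_projection
  obtain ⟨q, hq, hq'⟩ := Q.exists_continuous_projection
  have hpp : ∀ b, p (p b) = p b := fun b => hp' _ (hp b)
  have hqq : ∀ b, q (q b) = q b := fun b => hq' _ (hq b)
  set R : B × F →L[ℝ] B × F := p.prodMap q with hR
  -- The tangential part is that of `z - (b₀, 0)`, the transverse part that of the linearly
  -- corrected `Φ`. The derivative is `R + (1 - R) = id`, and the change lies in `P × Q`, so `S` is
  -- still the preimage of `P × Q`.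
  set f : B × F → B × F := fun z =>
    R (z - (b₀, 0)) + (ContinuousLinearMap.id ℝ (B × F) - R) (D.symm (Φ z - Φ (b₀, 0))) with hf
  have hfc : ContDiffOn ℝ ∞ f Φ.source := by
    have h1 : ContDiffOn ℝ ∞ (fun z => D.symm (Φ z - Φ (b₀, 0))) Φ.source :=
      D.symm.contDiff.comp_contDiffOn (hΦ.sub contDiffOn_const)
    exact (R.contDiff.comp (contDiff_id.sub contDiff_const)).contDiffOn.add
      ((ContinuousLinearMap.id ℝ (B × F) - R).contDiff.comp_contDiffOn h1)
  have hfd : HasFDerivAt f (ContinuousLinearMap.id ℝ (B × F)) (b₀, 0) := by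
    have h1 := R.hasFDerivAt.comp (b₀, (0 : F)) ((hasFDerivAt_id (b₀, (0 : F))).sub_const (b₀, 0))
    have h2 := (ContinuousLinearMap.id ℝ (B × F) - R).hasFDerivAt.comp (b₀, (0 : F))
      ((D.symm : B × F →L[ℝ] B × F).hasFDerivAt.comp (b₀, (0 : F)) (hD.sub_const (Φ (b₀, 0))))
    refine (h1.add h2).congr_fderiv ?_
    ext v <;> simp
  obtain ⟨X, hX, hXs, hXf, -⟩ := hfc.exists_openPartialHomeomorph Φ.open_source hb₀ hfd
  have hXf' : ⇑X = f := funext hXf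
  refine ⟨X, P, Q, p, q, hp, hp', hq, hq', hX, hXs, ?_, ?_, ?_, ?_, ?_, ?_⟩
  · rw [hXf']; exact hfc.mono hXs
  · rw [hXf']; exact hfd
  · simp [hXf', hf]
  · intro z hz
    rw [hL z (hXs hz)]
    have h1 : Φ z ∈ L ↔ D (D.symm (Φ z - Φ (b₀, 0))) ∈ L := by
      rw [D.apply_symm_apply]
      exact (L.sub_mem_iff_left hΦL).symm
    rw [h1, hT, hXf']
    refine and_congr ?_ ?_
    · exact P.mem_iff_add_sub_mem _ (hp _) (hp _)
    · exact Q.mem_iff_add_sub_mem _ (hq _) (hq _)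
  · intro z
    simp [hXf', hf, hR, hpp]
  · intro z
    simp [hXf', hf, hR, hqq]


/-- The local form of a submanifold of `B × F` that is stable under the homotheties of `F`: near
a point of `B × 0` it is, after a change of coordinates in `B` and a linear change of coordinates
in `F` depending on the base point, a product of linear subspaces. -/
theorem exists_local_product_form {S : Set (B × F)}
    (hS : ∀ t : ℝ, 0 ≤ t → ∀ z ∈ S, (z.1, t • z.2) ∈ S)
    {Φ : OpenPartialHomeomorph (B × F) (B × F)} (hΦ : ContDiffOn ℝ ∞ Φ Φ.source)
    (hΦ' : ContDiffOn ℝ ∞ Φ.symm Φ.target) {b₀ : B} (hb₀ : (b₀, (0 : F)) ∈ Φ.source)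
    (hbS : (b₀, (0 : F)) ∈ S) {L : Submodule ℝ (B × F)}
    (hL : ∀ z ∈ Φ.source, z ∈ S ↔ Φ z ∈ L) :
    ∃ (χ : OpenPartialHomeomorph B B) (A : B → F →L[ℝ] F) (P : Submodule ℝ B)
      (Q : Submodule ℝ F),
      b₀ ∈ χ.source ∧ (∀ b ∈ χ.source, (b, (0 : F)) ∈ Φ.source) ∧
      ContDiffOn ℝ ∞ χ χ.source ∧ ContDiffOn ℝ ∞ χ.symm χ.target ∧
      ContDiffOn ℝ ∞ A χ.source ∧ (∀ b ∈ χ.source, (A b).IsInvertible) ∧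
      (∀ b ∈ χ.source, (b, (0 : F)) ∈ S ↔ χ b ∈ P) ∧
      ∀ b ∈ χ.source, (b, (0 : F)) ∈ S → ∀ f, (b, f) ∈ S ↔ A b f ∈ Q := by
  have h0 : ∀ z ∈ S, (z.1, (0 : F)) ∈ S := fun z hz => by simpa using hS 0 le_rfl z hz
  obtain ⟨X, P, Q, p, q, hp, hp', hq, hq', hbX, hXs, hXc, hXd, hX0, hXS, hXp, hXq⟩ :=
    exists_normalized_slice_chart h0 hΦ hΦ' hb₀ hbS hL
  set W : Set B := {b | (b, (0 : F)) ∈ X.source} with hW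
  have hWo : IsOpen W := X.open_source.preimage (by fun_prop)
  set A : B → F →L[ℝ] F := fun b => (ContinuousLinearMap.snd ℝ B F).comp
    ((fderiv ℝ X (b, 0)).comp (ContinuousLinearMap.inr ℝ B F)) with hA
  have hXD : ∀ b ∈ W, HasFDerivAt X (fderiv ℝ X (b, 0)) (b, 0) := fun b hb =>
    ((hXc.contDiffAt (X.open_source.mem_nhds hb)).differentiableAt (by simp)).hasFDerivAt
  have hAc : ContDiffOn ℝ ∞ A W := by
    have h1 : ContDiffOn ℝ ∞ (fderiv ℝ X) X.source :=
      hXc.fderiv_of_isOpen X.open_source (by simp)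
    have h2 : ContDiffOn ℝ ∞ (fun b : B => fderiv ℝ X (b, 0)) W :=
      h1.comp (contDiff_id.prodMk contDiff_const).contDiffOn fun b hb => hb
    exact contDiffOn_const.clm_comp (h2.clm_comp contDiffOn_const)
  have hAb₀ : A b₀ = ContinuousLinearMap.id ℝ F := by
    simp only [hA, hXd.fderiv]
    ext f
    simp
  set O : Set B := W ∩ A ⁻¹' range ((↑) : (F ≃L[ℝ] F) → F →L[ℝ] F) with hO
  have hOo : IsOpen O := hAc.continuousOn.isOpen_inter_preimage hWo ContinuousLinearEquiv.isOpen
  have hbO : b₀ ∈ O := ⟨hbX, ⟨ContinuousLinearEquiv.refl ℝ F, hAb₀.symm⟩⟩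
  set g : B → B := fun b => (X (b, 0)).1 with hg
  have hgc : ContDiffOn ℝ ∞ g W :=
    contDiff_fst.comp_contDiffOn
      (hXc.comp (contDiff_id.prodMk contDiff_const).contDiffOn fun b hb => hb)
  have hgd : HasFDerivAt g (ContinuousLinearMap.id ℝ B) b₀ := by
    have h1 : HasFDerivAt (fun b : B => X (b, 0)) _ b₀ :=
      HasFDerivAt.comp (g := X) (f := fun b : B => (b, (0 : F))) b₀ hXd
        ((hasFDerivAt_id b₀).prodMk (hasFDerivAt_const (0 : F) b₀))
    refine ((ContinuousLinearMap.fst ℝ B F).hasFDerivAt.comp b₀ h1).congr_fderiv ?_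
    ext v
    simp
  obtain ⟨χ, hχb, hχO, hχg, hχ'⟩ :=
    (hgc.mono inter_subset_left : ContDiffOn ℝ ∞ g O).exists_openPartialHomeomorph hOo hbO hgd
  -- the base points of `S` are determined by the component of `χ` in `P`
  have hbase : ∀ b ∈ χ.source, ∀ z ∈ X.source, z ∈ S → z.1 ∈ χ.source → (X z).1 = χ b →
      z.1 = b := by
    intro b hb z hz hzS hzχ hzb
    have h1 := (hXS _ (hχO hzχ).1).1 (h0 z hzS)
    refine χ.injOn hzχ hb ?_
    have h2 : p (X (z.1, 0)).1 = p (X z).1 := by rw [hXp, hXp]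
    rw [hp' _ h1.1, hp' _ ((hXS z hz).1 hzS).1, hzb] at h2
    rw [hχg]
    exact h2
  -- On a smaller neighbourhood `X.symm (χ b, 0)` makes sense and `hbase` applies to it.
  have hwell : ∀ᶠ b in 𝓝 b₀, (χ b, (0 : F)) ∈ X.target ∧ (X.symm (χ b, 0)).1 ∈ χ.source := by
    have hc : ContinuousAt (fun b => (χ b, (0 : F))) b₀ :=
      (χ.continuousAt hχb).prodMk continuousAt_const
    have he : (χ b₀, (0 : F)) = X (b₀, 0) := by rw [hχg]; simp [hg, hX0]
    have hsy : ContinuousAt X.symm (χ b₀, (0 : F)) := by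
      rw [he]; exact X.continuousAt_symm (X.map_source hbX)
    refine (hc.eventually_mem (X.open_target.mem_nhds ?_)).and
      ((continuousAt_fst.comp (ContinuousAt.comp (f := fun b => (χ b, (0 : F))) hsy hc)).eventually_mem (χ.open_source.mem_nhds ?_))
    · rw [he]; exact X.map_source hbX
    · simp only [Function.comp, he, X.left_inv hbX, hχb]
  obtain ⟨O', hO', hO'o, hbO'⟩ := eventually_nhds_iff.1 hwell
  have hsub : (χ.restrOpen O' hO'o).source ⊆ χ.source := fun b hb => hb.1
  have hχc : ContDiffOn ℝ ∞ χ χ.source :=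
    ((hgc.mono inter_subset_left).mono hχO).congr fun b _ => hχg b
  -- Only `s ≥ 0` keeps `(b, s • f)` in `S`, hence the one-sided derivative at `0`.
  have hmem : ∀ b ∈ χ.source, (b, (0 : F)) ∈ S → ∀ f, (b, f) ∈ S → A b f ∈ Q := by
    intro b hb hbS' f hf
    have hbW : (b, (0 : F)) ∈ X.source := (hχO hb).1
    have hl : HasDerivAt (fun s : ℝ => ((b, s • f) : B × F)) (0, f) 0 := by
      simpa using (hasDerivAt_const (0 : ℝ) b).prodMk ((hasDerivAt_id (0 : ℝ)).smul_const f)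
    have hc : HasDerivAt (fun s : ℝ => X (b, s • f)) (fderiv ℝ X (b, 0) (0, f)) 0 :=
      HasFDerivAt.comp_hasDerivAt_of_eq (0 : ℝ) (hXD b (hχO hb).1) hl (by simp)
    have hc2 : HasDerivAt (fun s : ℝ => (X (b, s • f)).2) (A b f) 0 :=
      (ContinuousLinearMap.snd ℝ B F).hasFDerivAt.comp_hasDerivAt (0 : ℝ) hc
    refine Submodule.mem_of_hasDerivWithinAt_Ici hc2.hasDerivWithinAt ?_
    have hev : ∀ᶠ s : ℝ in 𝓝 0, (b, s • f) ∈ X.source :=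
      hl.continuousAt.eventually_mem (X.open_source.mem_nhds (by simpa using hbW))
    filter_upwards [hev.filter_mono nhdsWithin_le_nhds, self_mem_nhdsWithin] with s hs hs0
    exact ((hXS _ hs).1 (hS s hs0 _ hf)).2
  have hqA : ∀ b ∈ W, ∀ f, q (A b f) = q f := by
    intro b hb f
    have h1 : HasFDerivAt (fun z => q (X z).2) _ (b, (0 : F)) :=
      (q.comp (ContinuousLinearMap.snd ℝ B F)).hasFDerivAt.comp (b, (0 : F)) (hXD b hb)
    have h2 : HasFDerivAt (fun z => q (X z).2) (q.comp (ContinuousLinearMap.snd ℝ B F))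
        (b, (0 : F)) := by
      simp only [hXq]
      exact (q.comp (ContinuousLinearMap.snd ℝ B F)).hasFDerivAt
    exact DFunLike.congr_fun (h1.unique h2) (0, f)
  refine ⟨χ.restrOpen O' hO'o, A, P, Q, ⟨hχb, hbO'⟩, fun b hb => hXs (hχO hb.1).1,
    hχc.mono hsub, hχ'.mono fun y hy => hy.1, hAc.mono fun b hb => (hχO hb.1).1,
    fun b hb => (hχO hb.1).2, fun b hb => ⟨fun h => ?_, fun h => ?_⟩,
    fun b hb hbS' f => ⟨hmem b hb.1 hbS' f, fun hf => ?_⟩⟩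
  · have := ((hXS _ (hχO hb.1).1).1 h).1
    change χ b ∈ P
    rwa [hχg]
  -- The point of `S` with `X`-coordinates `(χ b, 0)` lies over `b` by `hbase`; retract it to the
  -- zero section.
  · change χ b ∈ P at h
    obtain ⟨ht, hs⟩ := hO' b hb.2
    have hzS : X.symm (χ b, 0) ∈ S := by
      rw [hXS _ (X.map_target ht), X.right_inv ht]
      exact ⟨h, Q.zero_mem⟩
    have hzb := hbase b hb.1 _ (X.map_target ht) hzS hs (by rw [X.right_inv ht])
    exact hzb ▸ h0 _ hzS
  · obtain ⟨hbW, D, hD⟩ := hχO hb.1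
    have hT := (hXS _ hbW).1 hbS'
    have hX2 : (X (b, 0)).2 = 0 := by
      rw [← hq' _ hT.2, hXq, map_zero]
    have hXb : X (b, 0) = (χ b, 0) := by rw [hχg]; exact Prod.ext rfl hX2
    have hc : ContinuousAt (fun s : ℝ => (χ b, s • A b f)) 0 := by fun_prop
    have he : (χ b, (0 : ℝ) • A b f) = X (b, 0) := by rw [hXb, zero_smul]
    have hsy : ContinuousAt X.symm (χ b, (0 : ℝ) • A b f) := by
      rw [he]; exact X.continuousAt_symm (X.map_source hbW)
    have hev : ∀ᶠ s : ℝ in 𝓝 0, (χ b, s • A b f) ∈ X.target ∧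
        (X.symm (χ b, s • A b f)).1 ∈ χ.source := by
      refine (hc.eventually_mem (X.open_target.mem_nhds ?_)).and
        ((continuousAt_fst.comp (ContinuousAt.comp (f := fun s : ℝ => (χ b, s • A b f)) hsy
          hc)).eventually_mem (χ.open_source.mem_nhds ?_))
      · rw [he]; exact X.map_source hbW
      · simp only [Function.comp, he, X.left_inv hbW, hb.1]
    -- A strictly positive `s`, so that the final rescaling by `s⁻¹` is possible.
    obtain ⟨s, ⟨hst, hss⟩, hs0⟩ :=
      ((hev.filter_mono nhdsWithin_le_nhds).and (self_mem_nhdsWithin (s := Ioi (0 : ℝ)))).exists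
    set z := X.symm (χ b, s • A b f) with hz
    have hXz : X z = (χ b, s • A b f) := X.right_inv hst
    have hzX : z ∈ X.source := X.map_target hst
    have hP : χ b ∈ P := by rw [hχg]; exact hT.1
    have hzS : z ∈ S := by
      rw [hXS _ hzX, hXz]
      exact ⟨hP, Q.smul_mem _ hf⟩
    have hzb := hbase b hb.1 z hzX hzS hss (by rw [hXz])
    have hz' : (b, z.2) ∈ S := by rw [← hzb]; exact hzS
    have hq2 : q z.2 = s • A b f := by
      rw [← hXq, hXz]
      exact hq' _ (Q.smul_mem _ hf)
    -- Both sides lie in `Q`, where `q` is the identity, and `q ∘ A b = q`. Injectivity of `A b`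
    -- then gives `z.2 = s • f`.
    have hAz : A b z.2 = A b (s • f) := by
      rw [← hq' _ (hmem b hb.1 hbS' _ hz'), hqA b hbW, hq2, map_smul]
    rw [← hD] at hAz
    rw [D.injective hAz] at hz'
    have := hS s⁻¹ (inv_nonneg.2 (le_of_lt hs0)) _ hz'
    simpa [smul_smul, inv_mul_cancel₀ (ne_of_gt hs0 : s ≠ 0)] using this

end Cone

/-! ### Changes of trivialization and of chart -/

section Trivialization

variable {B : Type*} [NormedAddCommGroup B] [NormedSpace ℝ B]
  {H : Type*} [TopologicalSpace H] {I : ModelWithCorners ℝ B H}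
  {M : Type*} [TopologicalSpace M] [ChartedSpace H M]
  {F : Type*} [NormedAddCommGroup F] [NormedSpace ℝ F]
  {V : M → Type*} [∀ x, AddCommGroup (V x)] [∀ x, Module ℝ (V x)]
  [TopologicalSpace (TotalSpace F V)] [∀ x, TopologicalSpace (V x)] [FiberBundle F V]

/-- A smooth trivialization may be modified by a smooth family of automorphisms of the fiber. -/
theorem IsSmoothLinearTrivialization.exists_twist [CompleteSpace F]
    {e : Trivialization F (π F V)}
    (he : IsSmoothLinearTrivialization I e) {U : Set M} (hU : IsOpen U) (hUe : U ⊆ e.baseSet)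
    {A : M → F →L[ℝ] F} (hA : ContMDiffOn I 𝓘(ℝ, F →L[ℝ] F) ∞ A U)
    (hA' : ∀ x ∈ U, (A x).IsInvertible) :
    ∃ e' : Trivialization F (π F V), IsSmoothLinearTrivialization I e' ∧ e'.baseSet = U ∧
      ∀ p : TotalSpace F V, p.proj ∈ U → (e' p).2 = A p.proj (e p).2 := by
  classical
  set φ : M → F ≃L[ℝ] F := fun x =>
    if h : x ∈ U then (hA' x h).choose else ContinuousLinearEquiv.refl ℝ F with hφ
  have hφA : ∀ x ∈ U, (φ x : F →L[ℝ] F) = A x := fun x hx => by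
    simp only [hφ, dif_pos hx]
    exact (hA' x hx).choose_spec
  have h1 : ContMDiffOn I 𝓘(ℝ, F →L[ℝ] F) ∞ (fun x => (φ x : F →L[ℝ] F)) U := hA.congr hφA
  have h2 : ContMDiffOn I 𝓘(ℝ, F →L[ℝ] F) ∞ (fun x => ((φ x).symm : F →L[ℝ] F)) U := by
    intro x hx
    have hi : ContDiffAt ℝ ∞ ContinuousLinearMap.inverse (φ x : F →L[ℝ] F) :=
      contDiffAt_map_inverse _
    refine (ContMDiffAt.comp_contMDiffWithinAt x hi.contMDiffAt (h1 x hx)).congr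
      (fun y _ => ?_) ?_ <;> exact (ContinuousLinearMap.inverse_equiv _).symm
  set f := FiberwiseLinear.openPartialHomeomorph φ hU h1.continuousOn h2.continuousOn with hf
  have hfs : f.source = U ×ˢ univ := rfl
  have hft : f.target = U ×ˢ univ := rfl
  have hsrc : (e.toOpenPartialHomeomorph ≫ₕ f).source = π F V ⁻¹' U := by
    ext p
    rw [OpenPartialHomeomorph.trans_source]
    refine ⟨fun h => ?_, fun h => ?_⟩
    · rw [mem_preimage, ← e.coe_fst h.1]; exact h.2.1
    · have hp : p ∈ e.source := e.mem_source.2 (hUe h)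
      refine ⟨hp, ?_, mem_univ _⟩
      change (e p).1 ∈ U
      rw [e.coe_fst hp]; exact h
  have htgt : (e.toOpenPartialHomeomorph ≫ₕ f).target = U ×ˢ univ := by
    ext z
    rw [OpenPartialHomeomorph.trans_target]
    refine ⟨fun h => h.1, fun h => ⟨h, e.mem_target.2 (hUe h.1)⟩⟩
  refine ⟨{ toOpenPartialHomeomorph := e.toOpenPartialHomeomorph ≫ₕ f
            baseSet := U
            open_baseSet := hU
            source_eq := hsrc
            target_eq := htgt
            proj_toFun := fun p hp => e.coe_fst hp.1 }, ⟨⟨fun b hb => ?_⟩, ?_, ?_⟩, rfl,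
    fun p hp => ?_⟩
  · have hl := he.linear.linear b (hUe hb)
    have hfst : ∀ v : V b, (e ⟨b, v⟩).1 = b := fun v => e.coe_fst' (hUe hb)
    have hv : ∀ v : V b, (f (e ⟨b, v⟩)).2 = φ b (e ⟨b, v⟩).2 := fun v => by
      change φ (e ⟨b, v⟩).1 _ = _
      rw [hfst]
    exact ⟨fun v w => by
        change (f (e ⟨b, v + w⟩)).2 = (f (e ⟨b, v⟩)).2 + (f (e ⟨b, w⟩)).2
        rw [hv, hv, hv, hl.map_add, map_add],
      fun c v => by
        change (f (e ⟨b, c • v⟩)).2 = c • (f (e ⟨b, v⟩)).2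
        rw [hv, hv, hl.map_smul, map_smul]⟩
  · have hfc : ContMDiffOn (I.prod 𝓘(ℝ, F)) (I.prod 𝓘(ℝ, F)) ∞ f (U ×ˢ univ) :=
      contMDiffOn_fst.prodMk
        ((h1.comp contMDiffOn_fst (prod_subset_preimage_fst _ _)).clm_apply contMDiffOn_snd)
    exact hfc.comp (he.contMDiffOn_toFun.mono fun p hp => hp.1) fun p hp => hp.2
  · have hfc : ContMDiffOn (I.prod 𝓘(ℝ, F)) (I.prod 𝓘(ℝ, F)) ∞ f.symm (U ×ˢ univ) :=
      contMDiffOn_fst.prodMk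
        ((h2.comp contMDiffOn_fst (prod_subset_preimage_fst _ _)).clm_apply contMDiffOn_snd)
    exact he.contMDiffOn_symm.comp (hfc.mono fun p hp => hp.1) fun p hp => hp.2
  · change φ (e p).1 (e p).2 = _
    rw [e.coe_fst' (hUe hp), ← hφA _ hp]
    rfl

end Trivialization

/-- Composing a chart with a smooth change of coordinates gives a chart. -/
theorem IsManifold.trans_mem_maximalAtlas {B : Type*} [NormedAddCommGroup B] [NormedSpace ℝ B]
    {M : Type*} [TopologicalSpace M] [ChartedSpace B M] [IsManifold 𝓘(ℝ, B) ∞ M]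
    {ψ : OpenPartialHomeomorph M B} (hψ : ψ ∈ IsManifold.maximalAtlas 𝓘(ℝ, B) ∞ M)
    {χ : OpenPartialHomeomorph B B} (hχ : ContDiffOn ℝ ∞ χ χ.source)
    (hχ' : ContDiffOn ℝ ∞ χ.symm χ.target) :
    ψ ≫ₕ χ ∈ IsManifold.maximalAtlas 𝓘(ℝ, B) ∞ M := by
  have hg : χ ∈ contDiffGroupoid ∞ 𝓘(ℝ, B) := by
    rw [contDiffGroupoid, mem_groupoid_of_pregroupoid]
    simpa [contDiffPregroupoid] using ⟨hχ, hχ'⟩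
  intro e he
  have h := hψ e he
  constructor
  · rw [OpenPartialHomeomorph.trans_symm_eq_symm_trans_symm, OpenPartialHomeomorph.trans_assoc]
    exact (contDiffGroupoid ∞ 𝓘(ℝ, B)).trans ((contDiffGroupoid ∞ 𝓘(ℝ, B)).symm hg) h.1
  · rw [← OpenPartialHomeomorph.trans_assoc]
    exact (contDiffGroupoid ∞ 𝓘(ℝ, B)).trans h.2 hg

/-! ### Globalization to the vector bundle -/

theorem theorem2p3
    {B : Type*} [NormedAddCommGroup B] [NormedSpace ℝ B] [FiniteDimensional ℝ B]
    {M : Type*} [TopologicalSpace M] [ChartedSpace B M] [IsManifold 𝓘(ℝ, B) ∞ M]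
    [T2Space M] [ParacompactSpace M]
    {F : Type*} [NormedAddCommGroup F] [NormedSpace ℝ F] [FiniteDimensional ℝ F]
    {V : M → Type*} [∀ x, AddCommGroup (V x)] [∀ x, Module ℝ (V x)]
    [TopologicalSpace (TotalSpace F V)] [∀ x, TopologicalSpace (V x)]
    [FiberBundle F V] [VectorBundle ℝ F V] [ContMDiffVectorBundle ∞ F V 𝓘(ℝ, B)]
    (S : Set (TotalSpace F V))
    (hS : IsEmbeddedSubmanifold (𝓘(ℝ, B).prod 𝓘(ℝ, F)) S)
    (hinv : ∀ t : ℝ, 0 ≤ t → ∀ p ∈ S, homothety F V t p ∈ S) :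
    ∃ N : Set M, IsVectorSubbundleOver 𝓘(ℝ, B) N S := by
  have key : ∀ x : M, (⟨x, 0⟩ : TotalSpace F V) ∈ S →
      ∃ (χ : OpenPartialHomeomorph B B) (A : B → F →L[ℝ] F) (P : Submodule ℝ B)
        (Q : Submodule ℝ F), chartAt B x x ∈ χ.source ∧
        ContDiffOn ℝ ∞ χ χ.source ∧ ContDiffOn ℝ ∞ χ.symm χ.target ∧
        ContDiffOn ℝ ∞ A χ.source ∧ (∀ b ∈ χ.source, (A b).IsInvertible) ∧
        (∀ y ∈ (chartAt B x ≫ₕ χ).source, y ∈ (trivializationAt F V x).baseSet) ∧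
        (∀ y ∈ (chartAt B x ≫ₕ χ).source,
          (⟨y, 0⟩ : TotalSpace F V) ∈ S ↔ χ (chartAt B x y) ∈ P) ∧
        ∀ p : TotalSpace F V, p.proj ∈ (chartAt B x ≫ₕ χ).source →
          (⟨p.proj, 0⟩ : TotalSpace F V) ∈ S →
          (p ∈ S ↔ A (chartAt B x p.proj) (trivializationAt F V x p).2 ∈ Q) := by
    intro x hx
    set ψ := chartAt B x with hψ
    set e := trivializationAt F V x with he
    obtain ⟨φ, hφ, hxφ, L, hL⟩ := hS _ hx
    set c := chartAt (ModelProd B F) (⟨x, 0⟩ : TotalSpace F V) with hc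
    have hce : c = e.toOpenPartialHomeomorph ≫ₕ ψ.prod (OpenPartialHomeomorph.refl F) :=
      FiberBundle.chartedSpace_chartAt _
    have hcs : ∀ p, p ∈ c.source ↔ p.proj ∈ e.baseSet ∧ p.proj ∈ ψ.source := by
      intro p
      rw [hce, OpenPartialHomeomorph.trans_source, mem_inter_iff]
      change p ∈ e.source ∧ ((e p).1 ∈ ψ.source ∧ (e p).2 ∈ univ) ↔ _
      rw [e.mem_source]
      constructor
      · rintro ⟨h, h', -⟩
        rw [e.coe_fst' h] at h'
        exact ⟨h, h'⟩
      · rintro ⟨h, h'⟩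
        rw [e.coe_fst' h]
        exact ⟨h, h', mem_univ _⟩
    have hca : ∀ p ∈ c.source, c p = (ψ p.proj, (e p).2) := by
      intro p hp
      rw [hce]
      change (ψ (e p).1, (e p).2) = _
      rw [e.coe_fst' ((hcs p).1 hp).1]
    have hxc : (⟨x, 0⟩ : TotalSpace F V) ∈ c.source := mem_chart_source _ _
    have hlin : ∀ y ∈ e.baseSet, IsLinearMap ℝ fun v : V y => (e ⟨y, v⟩).2 :=
      fun y hy => e.linear ℝ hy
    have hez : ∀ y ∈ e.baseSet, (e ⟨y, 0⟩).2 = 0 := fun y hy => (hlin y hy).map_zero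
    have hmg : c.symm ≫ₕ φ ∈ contDiffGroupoid ∞ (𝓘(ℝ, B).prod 𝓘(ℝ, F)) :=
      (contDiffGroupoid ∞ (𝓘(ℝ, B).prod 𝓘(ℝ, F))).compatible_of_mem_maximalAtlas
        (IsManifold.chart_mem_maximalAtlas _) hφ
    rw [contDiffGroupoid, mem_groupoid_of_pregroupoid] at hmg
    have hm1 : ContDiffOn ℝ ∞ (c.symm ≫ₕ φ : OpenPartialHomeomorph (B × F) (B × F))
        (c.symm ≫ₕ φ).source := by
      have := hmg.1
      simpa [contDiffPregroupoid] using this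
    have hm2 : ContDiffOn ℝ ∞ (c.symm ≫ₕ φ : OpenPartialHomeomorph (B × F) (B × F)).symm
        (c.symm ≫ₕ φ).target := by
      have := hmg.2
      simpa [contDiffPregroupoid] using this
    have hc0 : c ⟨x, 0⟩ = (ψ x, 0) := by
      rw [hca _ hxc, hez x (mem_baseSet_trivializationAt F V x)]
    -- The bundle chart is linear on fibers, so it turns `homothety` into scaling of the second
    -- factor.
    have hS' : ∀ t : ℝ, 0 ≤ t → ∀ z ∈ c.target ∩ c.symm ⁻¹' S,
        ((z.1, t • z.2) : B × F) ∈ c.target ∩ c.symm ⁻¹' S := by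
      rintro t ht z ⟨hz, hzS⟩
      have hp := c.map_target hz
      set p := c.symm z with hpz
      have hzp : z = (ψ p.proj, (e p).2) := by rw [← hca p hp, hpz, c.right_inv hz]
      have hh : homothety F V t p ∈ c.source := (hcs _).2 ((hcs p).1 hp)
      have hch : c (homothety F V t p) = (z.1, t • z.2) := by
        rw [hca _ hh, hzp]
        exact Prod.ext rfl ((hlin p.proj ((hcs p).1 hp).1).map_smul t p.snd)
      refine ⟨hch ▸ c.map_source hh, ?_⟩
      rw [mem_preimage, ← hch, c.left_inv hh]
      exact hinv t ht _ hzS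
    obtain ⟨χ, A, P, Q, hbχ, hχs, h1, h2, h3, h4, h5, h6⟩ :=
      exists_local_product_form (B := B) (F := F) (S := c.target ∩ c.symm ⁻¹' S) hS'
        (Φ := c.symm ≫ₕ φ) hm1 hm2 (b₀ := ψ x) (L := L)
        (by
          rw [← hc0]
          exact ⟨c.map_source hxc, by simpa [c.left_inv hxc] using hxφ⟩)
        (by
          rw [← hc0]
          exact ⟨c.map_source hxc, by simpa [c.left_inv hxc] using hx⟩)
        (fun z hz => by
          have h := hL (c.symm z) hz.2
          exact ⟨fun hz' => h.1 hz'.2, fun hz' => ⟨hz.1, h.2 hz'⟩⟩)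
    -- Pull `(ψ y, 0)` back through `c`: the resulting point lies over the base set, and injectivity
    -- of `ψ` puts it over `y`.
    have hbase : ∀ y ∈ (ψ ≫ₕ χ).source, y ∈ e.baseSet := by
      intro y hy
      have ht : ((ψ y, 0) : B × F) ∈ c.target := (hχs _ hy.2).1
      have := (hcs _).1 (c.map_target ht)
      have hfst : (c (c.symm (ψ y, 0))) = (ψ y, 0) := c.right_inv ht
      rw [hca _ (c.map_target ht)] at hfst
      have h7 := ψ.injOn this.2 hy.1 (congrArg Prod.fst hfst)
      exact h7 ▸ this.1
    have hmemc : ∀ p : TotalSpace F V, p.proj ∈ (ψ ≫ₕ χ).source →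
        (((ψ p.proj, (e p).2) : B × F) ∈ c.target ∩ c.symm ⁻¹' S ↔ p ∈ S) := by
      intro p hp
      have hpc : p ∈ c.source := (hcs p).2 ⟨hbase _ hp, hp.1⟩
      rw [← hca p hpc, mem_inter_iff, mem_preimage, c.left_inv hpc]
      exact and_iff_right (c.map_source hpc)
    have hmem0 : ∀ y ∈ (ψ ≫ₕ χ).source,
        (((ψ y, 0) : B × F) ∈ c.target ∩ c.symm ⁻¹' S ↔ (⟨y, 0⟩ : TotalSpace F V) ∈ S) := by
      intro y hy
      rw [← hmemc ⟨y, 0⟩ hy, hez y (hbase y hy)]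
    refine ⟨χ, A, P, Q, hbχ, h1, h2, h3, h4, hbase, fun y hy => ?_, fun p hp hp0 => ?_⟩
    · rw [← hmem0 y hy]
      exact h5 _ hy.2
    · rw [← hmemc p hp]
      exact h6 _ hp.2 ((hmem0 _ hp).2 hp0) _
  -- The case `t = 0` of `hinv` shows that this set contains the projection of `S`.
  refine ⟨{x | (⟨x, 0⟩ : TotalSpace F V) ∈ S}, ?_, fun p hp => ?_, fun x hx => ?_⟩
  · intro x hx
    obtain ⟨χ, A, P, Q, hbχ, h1, h2, -, -, -, h5, -⟩ := key x hx
    exact ⟨chartAt B x ≫ₕ χ,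
      IsManifold.trans_mem_maximalAtlas (IsManifold.chart_mem_maximalAtlas x) h1 h2,
      ⟨mem_chart_source B x, hbχ⟩, P, h5⟩
  · have := hinv 0 le_rfl p hp
    simpa [homothety] using this
  · obtain ⟨χ, A, P, Q, hbχ, -, -, h3, h4, hbase, -, h6⟩ := key x hx
    have he : IsSmoothLinearTrivialization 𝓘(ℝ, B) (trivializationAt F V x) :=
      ⟨inferInstance, (trivializationAt F V x).contMDiffOn,
        (trivializationAt F V x).contMDiffOn_symm⟩
    have hA : ContMDiffOn 𝓘(ℝ, B) 𝓘(ℝ, F →L[ℝ] F) ∞ (fun y => A (chartAt B x y))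
        (chartAt B x ≫ₕ χ).source :=
      h3.contMDiffOn.comp (contMDiffOn_chart.mono fun y hy => hy.1) fun y hy => hy.2
    obtain ⟨e', he', hb', hee'⟩ := he.exists_twist (chartAt B x ≫ₕ χ).open_source hbase hA
      fun y hy => h4 _ hy.2
    refine ⟨e', he', hb' ▸ ⟨mem_chart_source B x, hbχ⟩, Q, fun p hp => ?_⟩
    rw [hb'] at hp
    rw [h6 p hp.2 hp.1, hee' p hp.2]
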